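/- A (distributive) p-algebra is an algebra $(A,\wedge,\vee,{}^*,0,1)$ such that $(A,\wedge,\vee,0,1)$ is a bounded distributive lattice and, for all $x,y\in A$, $x\wedge y=0$ if and only if $x\le y^*$ (one-element algebras are allowed). Let $\mathsf{Pa}$ be the class of all p-algebras. For $k\in\mathbb{N}=\{0,1,2,\dots\}$ let $\bar{\mathbf B}_k$ be the finite p-algebra obtained from the Boolean algebra with $k$ atoms by adding a new top element above its old top, and let $\mathsf{Pa}_k=\mathbf{HSP}(\bar{\mathbf B}_k)$ be the variety it generates; let $\mathsf{Pa}_{-1}$ be the class of one-element p-algebras. A quasivariety of p-algebras is a class of p-algebras axiomatized, within $\mathsf{Pa}$, by a set of quasi-identities $s_1=t_1\,\&\cdots\&\,s_n=t_n\Rightarrow s=t$ ($n\ge 0$). Write $\mathbf Q(\mathbf A)$ for the least quasivariety of p-algebras containing $\mathbf A$. **Lemma 2.1.** Let $m\in\{-1,0,1,2,\dots\}$ and let $\mathsf K$ be a cover of $\mathsf{Pa}_m$ in the lattice of quasivarieties of p-algebras, i.e. $\mathsf K$ is a quasivariety of p-algebras, $\mathsf{Pa}_m\subsetneq\mathsf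 K$, and there is no quasivariety $\mathsf L$ of p-algebras with $\mathsf{Pa}_m\subsetneq\mathsf L\subsetneq\mathsf K$. Then there is a finite p-algebra $\mathbf A$ with $\mathsf K=\mathbf Q(\mathbf A)$. -/

import Mathlib

universe u v

/-- A (distributive) p-algebra: a bounded distributive lattice with a unary operation `ᶜ`
(written `*` in the literature) such that `x ∧ y = 0` if and only if `x ≤ y*`.
The one-element algebra (in which `⊥ = ⊤`) is allowed. -/
class PAlgebra (α : Type u) extends DistribLattice α, BoundedOrder α, Compl α where
  inf_eq_bot_iff_le_compl : ∀ x y : α, x ⊓ y = ⊥ ↔ x ≤ yᶜ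

/-- The class of all p-algebras (with carrier in `Type u`). -/
structure PAlg : Type (u + 1) where
  carrier : Type u
  [str : PAlgebra carrier]

namespace PAlg

instance : CoeSort PAlg.{u} (Type u) := ⟨PAlg.carrier⟩

instance (A : PAlg.{u}) : PAlgebra A := A.str

/-- Homomorphisms of p-algebras: maps preserving all the basic operations. -/
structure IsHom {α : Type u} {β : Type v} [PAlgebra α] [PAlgebra β] (f : α → β) : Prop where
  map_bot : f ⊥ = ⊥
  map_top : f ⊤ = ⊤
  map_inf : ∀ x y, f (x ⊓ y) = f x ⊓ f y
  map_sup : ∀ x y, f (x ⊔ y) = f x ⊔ f y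
  map_compl : ∀ x, f xᶜ = (f x)ᶜ

/-- Direct products of p-algebras, with the pointwise operations. -/
instance instPAlgebraPi {ι : Type v} (F : ι → Type u) [∀ i, PAlgebra (F i)] :
    PAlgebra (∀ i, F i) where
  inf_eq_bot_iff_le_compl x y := by
    simp only [funext_iff, Pi.le_def, Pi.inf_apply, Pi.bot_apply, Pi.compl_apply,
      PAlgebra.inf_eq_bot_iff_le_compl]

/-! ### The class operators `H`, `S`, `P` -/

/-- The class of all homomorphic images of members of `C`. -/
def H (C : Set PAlg.{u}) : Set PAlg.{u} :=
  {A | ∃ B ∈ C, ∃ f : B → A, IsHom f ∧ Function.Surjective f}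

/-- The class of all algebras isomorphic to a subalgebra of a member of `C`. -/
def S (C : Set PAlg.{u}) : Set PAlg.{u} :=
  {A | ∃ B ∈ C, ∃ f : A → B, IsHom f ∧ Function.Injective f}

/-- The class of all algebras isomorphic to a direct product of a (possibly empty) family
of members of `C`. -/
def P (C : Set PAlg.{u}) : Set PAlg.{u} :=
  {A | ∃ (ι : Type u) (F : ι → PAlg.{u}), (∀ i, F i ∈ C) ∧
    ∃ f : A → (∀ i, F i), IsHom f ∧ Function.Bijective f}

/-! ### The algebras `B̄ₖ` and the varieties `Paₘ` -/

/-- The powerset Boolean algebra of `X` with a new top element `⊤` added above its old top.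
A new top element has pseudocomplement `⊥`, the pseudocomplement of `⊥` is the new top, and
a nonempty set has its usual complement as pseudocomplement. -/
noncomputable instance instPAlgebraWithTopSet (X : Type u) : PAlgebra (WithTop (Set X)) where
  compl := fun a => open Classical in
    match a with
    | none => ((∅ : Set X) : WithTop (Set X))
    | some s => if s = ∅ then ⊤ else ((sᶜ : Set X) : WithTop (Set X))
  inf_eq_bot_iff_le_compl := by
    have hbot : (⊥ : WithTop (Set X)) = ((∅ : Set X) : WithTop (Set X)) := rfl
    intro x y
    induction y using WithTop.recTopCoe with
    | top =>
      change x ⊓ ⊤ = ⊥ ↔ x ≤ ((∅ : Set X) : WithTop (Set X))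
      rw [inf_top_eq, ← hbot, le_bot_iff]
    | coe t =>
      change x ⊓ (t : WithTop (Set X)) = ⊥ ↔
        x ≤ open Classical in
          (if t = ∅ then ⊤ else ((tᶜ : Set X) : WithTop (Set X)))
      by_cases ht : t = ∅
      · subst ht
        rw [if_pos rfl, ← hbot]
        simp
      · rw [if_neg ht]
        induction x using WithTop.recTopCoe with
        | top =>
          rw [top_inf_eq, hbot]
          simp [ht]
        | coe s =>
          rw [← WithTop.coe_inf, hbot, WithTop.coe_eq_coe, WithTop.coe_le_coe]
          exact Set.disjoint_iff_inter_eq_empty.symm.trans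
            Set.subset_compl_iff_disjoint_right.symm

/-- `B̄ₖ`: the Boolean algebra with `k` atoms with an extra cover of the top element. -/
noncomputable def Bbar (k : ℕ) : PAlg.{u} where
  carrier := WithTop (Set (ULift.{u} (Fin k)))

/-- The varieties `Pa₋₁ ⊂ Pa₀ ⊂ Pa₁ ⊂ ⋯`. The index `⊥` stands for `-1`: `Pa ⊥` is the trivial
variety of one-element p-algebras; for `k : ℕ`, `Pa k = HSP(B̄ₖ)`. -/
noncomputable def Pa : WithBot ℕ → Set PAlg.{u}
  | none => {A | Subsingleton A}
  | some k => H (S (P {Bbar k}))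

/-! ### Quasi-identities and quasivarieties -/

/-- Terms in the language of p-algebras, in the variables `x₀, x₁, x₂, …`. -/
inductive Term : Type
  | var (n : ℕ) : Term
  | bot : Term
  | top : Term
  | inf (s t : Term) : Term
  | sup (s t : Term) : Term
  | compl (t : Term) : Term

/-- The value of a term under an assignment of the variables. -/
def Term.eval {α : Type u} [PAlgebra α] (v : ℕ → α) : Term → α
  | .var n => v n
  | .bot => ⊥
  | .top => ⊤
  | .inf s t => s.eval v ⊓ t.eval v
  | .sup s t => s.eval v ⊔ t.eval v
  | .compl t => (t.eval v)ᶜ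

/-- A quasi-identity `s₁ = t₁ ∧ ⋯ ∧ sₙ = tₙ → s = t`, with `n ≥ 0` premises. -/
structure QuasiIdentity : Type where
  premises : List (Term × Term)
  conclusion : Term × Term

/-- `A` satisfies the quasi-identity `q` (under all assignments). -/
def Satisfies (A : PAlg.{u}) (q : QuasiIdentity) : Prop :=
  ∀ v : ℕ → A, (∀ e ∈ q.premises, e.1.eval v = e.2.eval v) →
    q.conclusion.1.eval v = q.conclusion.2.eval v

/-- A quasivariety of p-algebras: a class of p-algebras axiomatized, among all p-algebras, by a
set of quasi-identities. -/
def IsQuasivariety (K : Set PAlg.{u}) : Prop :=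
  ∃ Γ : Set QuasiIdentity, K = {A | ∀ q ∈ Γ, Satisfies A q}

/-- `Q C`: the quasivariety generated by `C`, i.e. the least quasivariety containing `C`. -/
def Q (C : Set PAlg.{u}) : Set PAlg.{u} :=
  ⋂₀ {K | IsQuasivariety K ∧ C ⊆ K}

/-- `K` covers `V` in the lattice of quasivarieties of p-algebras: `K` is a quasivariety properly
containing `V`, and no quasivariety lies strictly between. -/
def IsCover (V K : Set PAlg.{u}) : Prop :=
  IsQuasivariety K ∧ V ⊂ K ∧ ∀ L : Set PAlg.{u}, IsQuasivariety L → V ⊂ L → ¬ L ⊂ K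

end PAlg

/-!
Finitely generated p-algebras are finite and a quasi-identity involves only finitely many variables,
so a quasivariety not contained in a quasivariety `V` has a finite member `C ∉ V`. Let `K` cover
`V = Q {D}` with `D` finite, and take such a `C ∈ K`. A nontrivial p-algebra has a homomorphism to
every p-algebra, so `C` embeds in `C × D` as the graph of a homomorphism, and so does `D` unless it
is trivial. Hence `V ⊂ Q {C × D} ⊆ K`, and `K = Q {C × D}`.

Each `Paₘ` has the form `Q {D}`: for a prime filter `P`, recording which maximal filters properly
above `P` contain an element `x ∉ P`, and sending `P` to the new top, gives a homomorphism to a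
powerset with a new top. These homomorphisms separate points. By Lee's identity, `P` has at most `k`
maximal filters properly above it, so for its models the target can be taken to be `B̄ₖ`. The same
homomorphisms show that a finitely generated p-algebra is finite, as it has only finitely many
maximal filters.
-/

namespace PAlg

section Pseudocomplement

variable {α : Type u} [PAlgebra α] {x y z : α}

theorem le_compl_iff_disjoint : x ≤ yᶜ ↔ Disjoint x y := by
  rw [disjoint_iff, PAlgebra.inf_eq_bot_iff_le_compl]

theorem disjoint_compl_self (x : α) : Disjoint xᶜ x :=
  le_compl_iff_disjoint.1 le_rfl

theorem top_compl : (⊤ : α)ᶜ = ⊥ :=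
  disjoint_top.1 (disjoint_compl_self ⊤)

theorem compl_eq_top : xᶜ = ⊤ ↔ x = ⊥ := by
  rw [← top_le_iff, le_compl_iff_disjoint, top_disjoint]

theorem le_compl_compl (x : α) : x ≤ xᶜᶜ :=
  le_compl_iff_disjoint.2 (disjoint_compl_self x).symm

theorem compl_sup_compl_self (x : α) : (x ⊔ xᶜ)ᶜ = ⊥ := by
  obtain ⟨hx, hxc⟩ := disjoint_sup_right.1 (disjoint_compl_self (x ⊔ xᶜ))
  exact disjoint_self.1 (hxc.mono_right (le_compl_iff_disjoint.2 hx))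

theorem le_compl_compl_inf (hy : x ≤ yᶜᶜ) (hz : x ≤ zᶜᶜ) : x ≤ (y ⊓ z)ᶜᶜ := by
  rw [le_compl_iff_disjoint] at hy hz ⊢
  set u := x ⊓ (y ⊓ z)ᶜ
  have hu : Disjoint (u ⊓ y) z := by
    rw [disjoint_assoc]
    exact (disjoint_compl_self (y ⊓ z)).mono_left inf_le_right
  have huy : Disjoint u y := disjoint_iff.2 (disjoint_self.1
    (hz.mono (inf_le_left.trans inf_le_left) (le_compl_iff_disjoint.2 hu)))
  exact disjoint_iff.2 (disjoint_self.1
    (hy.mono inf_le_left (le_compl_iff_disjoint.2 huy)))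

/-- For a sequence `v`, the part of `v i` outside the earlier entries:
`v i ⊓ (v 0 ⊔ ⋯ ⊔ v (i - 1))ᶜ`. -/
def disjointPart (v : ℕ → α) (i : ℕ) : α :=
  v i ⊓ ((Finset.range i).sup v)ᶜ

theorem disjointPart_zero (v : ℕ → α) : disjointPart v 0 = v 0 := by
  rw [disjointPart, Finset.range_zero, Finset.sup_empty, compl_eq_top.2 rfl, inf_top_eq]

theorem pairwise_disjoint_disjointPart (v : ℕ → α) :
    Pairwise (Function.onFun Disjoint (disjointPart v)) := by
  refine (pairwise_disjoint_on _).2 fun i j hij => ?_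
  exact (disjoint_compl_self _).symm.mono
    (inf_le_left.trans (Finset.le_sup (Finset.mem_range.2 hij))) inf_le_right

/-- A Boolean algebra is a p-algebra whose pseudocomplement is the complement. -/
abbrev ofBooleanAlgebra (β : Type v) [BooleanAlgebra β] : PAlgebra β where
  inf_eq_bot_iff_le_compl x y := by rw [← disjoint_iff, le_compl_iff_disjoint_right]

instance instPAlgebraProp : PAlgebra Prop := ofBooleanAlgebra Prop

instance instPAlgebraPUnit : PAlgebra PUnit.{u + 1} := ofBooleanAlgebra PUnit

instance instPAlgebraProd {β : Type v} [PAlgebra β] : PAlgebra (α × β) where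
  compl x := (x.1ᶜ, x.2ᶜ)
  inf_eq_bot_iff_le_compl x y := by
    rw [Prod.ext_iff, Prod.le_def]
    exact and_congr (PAlgebra.inf_eq_bot_iff_le_compl _ _) (PAlgebra.inf_eq_bot_iff_le_compl _ _)

end Pseudocomplement

section Homomorphisms

variable {α : Type*} {β : Type*} {γ : Type*} [PAlgebra α] [PAlgebra β] [PAlgebra γ]

theorem isHom_id : IsHom (id : α → α) :=
  ⟨rfl, rfl, fun _ _ => rfl, fun _ _ => rfl, fun _ => rfl⟩

theorem isHom_fst : IsHom (Prod.fst : α × β → α) :=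
  ⟨rfl, rfl, fun _ _ => rfl, fun _ _ => rfl, fun _ => rfl⟩

theorem isHom_snd : IsHom (Prod.snd : α × β → β) :=
  ⟨rfl, rfl, fun _ _ => rfl, fun _ _ => rfl, fun _ => rfl⟩

theorem isHom_eval {ι : Type*} (F : ι → Type*) [∀ i, PAlgebra (F i)] (i : ι) :
    IsHom (Function.eval i : (∀ i, F i) → F i) :=
  ⟨rfl, rfl, fun _ _ => rfl, fun _ _ => rfl, fun _ => rfl⟩

theorem isHom_pi {ι : Type*} {F : ι → Type*} [∀ i, PAlgebra (F i)] {f : ∀ i, α → F i}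
    (hf : ∀ i, IsHom (f i)) : IsHom fun x i => f i x where
  map_bot := funext fun i => (hf i).map_bot
  map_top := funext fun i => (hf i).map_top
  map_inf x y := funext fun i => (hf i).map_inf x y
  map_sup x y := funext fun i => (hf i).map_sup x y
  map_compl x := funext fun i => (hf i).map_compl x

theorem IsHom.comp {g : β → γ} {f : α → β} (hg : IsHom g) (hf : IsHom f) : IsHom (g ∘ f) where
  map_bot := by simp only [Function.comp_apply, hf.map_bot, hg.map_bot]
  map_top := by simp only [Function.comp_apply, hf.map_top, hg.map_top]
  map_inf x y := by simp only [Function.comp_apply, hf.map_inf, hg.map_inf]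
  map_sup x y := by simp only [Function.comp_apply, hf.map_sup, hg.map_sup]
  map_compl x := by simp only [Function.comp_apply, hf.map_compl, hg.map_compl]

theorem IsHom.prodMk {f : α → β} {g : α → γ} (hf : IsHom f) (hg : IsHom g) :
    IsHom fun x => (f x, g x) where
  map_bot := Prod.ext hf.map_bot hg.map_bot
  map_top := Prod.ext hf.map_top hg.map_top
  map_inf x y := Prod.ext (hf.map_inf x y) (hg.map_inf x y)
  map_sup x y := Prod.ext (hf.map_sup x y) (hg.map_sup x y)
  map_compl x := Prod.ext (hf.map_compl x) (hg.map_compl x)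

theorem IsHom.map_eval {f : α → β} (hf : IsHom f) (v : ℕ → α) (t : Term) :
    f (t.eval v) = t.eval (f ∘ v) := by
  induction t with
  | var n => rfl
  | bot => exact hf.map_bot
  | top => exact hf.map_top
  | inf s t hs ht => simp only [Term.eval, hf.map_inf, hs, ht]
  | sup s t hs ht => simp only [Term.eval, hf.map_sup, hs, ht]
  | compl t ht => simp only [Term.eval, hf.map_compl, ht]

/-- The bounded lattice homomorphism underlying a homomorphism of p-algebras. -/
def IsHom.toBoundedLatticeHom {f : α → β} (hf : IsHom f) : BoundedLatticeHom α β where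
  toFun := f
  map_sup' := hf.map_sup
  map_inf' := hf.map_inf
  map_top' := hf.map_top
  map_bot' := hf.map_bot

theorem IsHom.map_finset_sup {f : α → β} (hf : IsHom f) {ι : Type*} (s : Finset ι) (g : ι → α) :
    f (s.sup g) = s.sup (f ∘ g) :=
  _root_.map_finset_sup hf.toBoundedLatticeHom s g

theorem IsHom.map_finset_inf {f : α → β} (hf : IsHom f) {ι : Type*} (s : Finset ι) (g : ι → α) :
    f (s.inf g) = s.inf (f ∘ g) :=
  _root_.map_finset_inf hf.toBoundedLatticeHom s g

theorem IsHom.compl_iff {M : α → Prop} (hM : IsHom M) {x : α} : M xᶜ ↔ ¬ M x :=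
  iff_of_eq (hM.map_compl x)

open Classical in
theorem isHom_ite_top_bot : IsHom fun p : Prop => if p then (⊤ : α) else ⊥ where
  map_bot := if_neg not_false
  map_top := if_pos trivial
  map_inf p q := by by_cases p <;> by_cases q <;> simp [*]
  map_sup p q := by by_cases p <;> by_cases q <;> simp [*]
  map_compl p := by by_cases p <;> simp [*, top_compl, compl_eq_top.2]

end Homomorphisms

section PrimeFilters

/-- Prime filters of a bounded lattice, encoded by their membership predicates. For a p-algebra,
the maximal ones are the `M : α → Prop` with `IsHom M`. -/
abbrev PrimeFilter (α : Type*) [Lattice α] [BoundedOrder α] : Type _ :=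
  BoundedLatticeHom α Prop

section BoundedLattice

variable {α : Type*} [Lattice α] [BoundedOrder α] (P : PrimeFilter α) {x y : α}

theorem PrimeFilter.inf_iff : P (x ⊓ y) ↔ P x ∧ P y :=
  iff_of_eq (map_inf P x y)

theorem PrimeFilter.sup_iff : P (x ⊔ y) ↔ P x ∨ P y :=
  iff_of_eq (map_sup P x y)

theorem PrimeFilter.top : P ⊤ :=
  of_eq_true (map_top P)

theorem PrimeFilter.not_bot : ¬ P ⊥ :=
  of_eq_false (map_bot P)

theorem PrimeFilter.mono (h : x ≤ y) : P x → P y :=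
  OrderHomClass.mono P h

end BoundedLattice

theorem finset_sup_prop_iff {ι : Type*} {s : Finset ι} {p : ι → Prop} :
    s.sup p ↔ ∃ i ∈ s, p i := by
  simp only [Finset.sup_eq_iSup, iSup_Prop_eq, exists_prop]

theorem finset_inf_prop_iff {ι : Type*} {s : Finset ι} {p : ι → Prop} :
    s.inf p ↔ ∀ i ∈ s, p i := by
  simp only [Finset.inf_eq_iInf, iInf_Prop_eq]

theorem exists_primeFilter_of_notMem {α : Type*} [DistribLattice α] [BoundedOrder α]
    {F : Order.PFilter α} {b : α} (hb : b ∉ F) :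
    ∃ P : PrimeFilter α, (∀ a ∈ F, P a) ∧ ¬ P b := by
  have hdisj : Disjoint (F : Set α) (Order.Ideal.principal b : Set α) :=
    Set.disjoint_left.2 fun x hx hxb => hb (Order.PFilter.mem_of_le hxb hx)
  obtain ⟨J, hJ, hbJ, hFJ⟩ := DistribLattice.prime_ideal_of_disjoint_filter_ideal hdisj
  have hFJ' : ∀ a ∈ F, a ∉ J := fun _ ha => Set.disjoint_left.1 hFJ ha
  let P : PrimeFilter α :=
    { toFun := fun x => x ∉ J
      map_sup' := fun _ _ => propext (Order.Ideal.sup_mem_iff.not.trans not_and_or)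
      map_inf' := fun _ _ => propext <| Iff.trans (not_congr
        ⟨hJ.mem_or_mem, Or.rec (J.lower inf_le_left) (J.lower inf_le_right)⟩) not_or
      map_top' := eq_true (hFJ' ⊤ Order.PFilter.top_mem)
      map_bot' := eq_false (not_not.2 J.bot_mem) }
  exact ⟨P, hFJ', not_not.2 (hbJ Order.Ideal.mem_principal_self)⟩

theorem exists_primeFilter_of_ne {α : Type*} [DistribLattice α] [BoundedOrder α] {a b : α}
    (h : a ≠ b) : ∃ P : PrimeFilter α, ¬ (P a ↔ P b) := by
  have of_not_le {a b : α} (hab : ¬ a ≤ b) : ∃ P : PrimeFilter α, P a ∧ ¬ P b :=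
    (exists_primeFilter_of_notMem (F := .principal a) hab).imp fun P hP =>
      ⟨hP.1 a (Order.PFilter.mem_principal.2 le_rfl), hP.2⟩
  rcases not_and_or.1 (mt le_antisymm_iff.2 h) with hab | hba
  · obtain ⟨P, ha, hb⟩ := of_not_le hab
    exact ⟨P, fun h => hb (h.1 ha)⟩
  · obtain ⟨P, hb, ha⟩ := of_not_le hba
    exact ⟨P, fun h => ha (h.2 hb)⟩

variable {α : Type u} [PAlgebra α]

theorem PrimeFilter.not_of_compl (P : PrimeFilter α) {x : α} (hxc : P xᶜ) : ¬ P x := fun hx =>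
  P.not_bot ((disjoint_compl_self x).eq_bot ▸ P.inf_iff.2 ⟨hxc, hx⟩)

/-- The filter of all `z` such that `p ⊓ x ≤ zᶜᶜ` for some `p` in the prime filter `P`: it is
generated by `P`, `x` and the dense elements (those with `zᶜ = ⊥`). -/
def PrimeFilter.denseExtension (P : PrimeFilter α) (x : α) : Order.PFilter α :=
  Order.IsPFilter.toPFilter (F := {z | ∃ p, P p ∧ p ⊓ x ≤ zᶜᶜ}) <| by
    refine .of_def ⟨⊤, ⊤, P.top, le_top.trans (le_compl_compl ⊤)⟩ ?_ ?_
    · rintro y ⟨p, hp, hy⟩ z ⟨q, hq, hz⟩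
      exact ⟨y ⊓ z, ⟨p ⊓ q, P.inf_iff.2 ⟨hp, hq⟩, le_compl_compl_inf
        ((inf_le_inf_right x inf_le_left).trans hy) ((inf_le_inf_right x inf_le_right).trans hz)⟩,
        inf_le_left, inf_le_right⟩
    · rintro y z hyz ⟨p, hp, hy⟩
      have hzy : zᶜ ≤ yᶜ := le_compl_iff_disjoint.2 ((disjoint_compl_self z).mono_right hyz)
      exact ⟨p, hp, le_compl_iff_disjoint.2 ((le_compl_iff_disjoint.1 hy).mono_right hzy)⟩

theorem PrimeFilter.mem_denseExtension {P : PrimeFilter α} {x z : α} :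
    z ∈ P.denseExtension x ↔ ∃ p, P p ∧ p ⊓ x ≤ zᶜᶜ :=
  Iff.rfl

/-- A prime filter containing all dense elements contains `y ⊔ yᶜ` for every `y`, hence is
maximal. -/
theorem PrimeFilter.exists_isHom_le (P : PrimeFilter α) {x : α} (hx : ¬ P xᶜ) :
    ∃ M : α → Prop, IsHom M ∧ ⇑P ≤ M ∧ M x := by
  have hbot : ⊥ ∉ P.denseExtension x := by
    rw [mem_denseExtension]
    rintro ⟨p, hp, hpx⟩
    rw [compl_eq_top.2 rfl, top_compl, ← disjoint_iff_inf_le, ← le_compl_iff_disjoint] at hpx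
    exact hx (P.mono hpx hp)
  obtain ⟨M, hFM, -⟩ := exists_primeFilter_of_notMem hbot
  have hdense (y : α) : M (y ⊔ yᶜ) := hFM _ <| mem_denseExtension.2
    ⟨⊤, P.top, by rw [compl_sup_compl_self, compl_eq_top.2 rfl]; exact le_top⟩
  refine ⟨M, ⟨map_bot M, map_top M, map_inf M, map_sup M, fun y => propext ?_⟩,
    fun p hp => hFM p ⟨p, hp, inf_le_left.trans (le_compl_compl p)⟩,
    hFM x ⟨⊤, P.top, inf_le_right.trans (le_compl_compl x)⟩⟩
  exact ⟨M.not_of_compl, fun hy => (M.sup_iff.1 (hdense y)).resolve_left hy⟩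

theorem exists_isHom_of_nontrivial [Nontrivial α] (β : Type v) [PAlgebra β] :
    ∃ f : α → β, IsHom f := by
  obtain ⟨P, -⟩ := exists_primeFilter_of_ne (bot_ne_top (α := α))
  obtain ⟨M, hM, -⟩ := P.exists_isHom_le (x := ⊤) fun h => P.not_of_compl h P.top
  exact ⟨_, isHom_ite_top_bot.comp hM⟩

/-- Two distinct homomorphisms to `Prop` are incomparable, since both commute with `ᶜ`. -/
theorem IsHom.exists_apply_and_not_apply {M N : α → Prop} (hM : IsHom M) (hN : IsHom N)
    (h : M ≠ N) : ∃ x, M x ∧ ¬ N x := by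
  obtain ⟨x, hx⟩ := Function.ne_iff.1 h
  by_cases hMx : M x
  · exact ⟨x, hMx, fun hNx => hx (propext (iff_of_true hMx hNx))⟩
  · have hNx : N x := by_contra fun hNx => hx (propext (iff_of_false hMx hNx))
    exact ⟨xᶜ, hM.compl_iff.2 hMx, fun hNxc => hN.compl_iff.1 hNxc hNx⟩

theorem exists_apply_iff_eq {ι : Type*} [Finite ι] {M : ι → α → Prop} (hM : ∀ i, IsHom (M i))
    (hinj : Function.Injective M) : ∃ y : ι → α, ∀ i j, M i (y j) ↔ i = j := by
  have := Fintype.ofFinite ι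
  have hsep (i j : ι) : ∃ z, M j z ∧ (M i z → i = j) := by
    by_cases hij : i = j
    · exact ⟨⊤, of_eq_true (hM j).map_top, fun _ => hij⟩
    · obtain ⟨z, hj, hi⟩ := (hM j).exists_apply_and_not_apply (hM i) (hinj.ne hij).symm
      exact ⟨z, hj, fun h => absurd h hi⟩
  choose z hz hz' using hsep
  have hinf (i j : ι) : M i (Finset.univ.inf fun l => z l j) ↔ ∀ l, M i (z l j) := by
    simp only [(hM i).map_finset_inf, finset_inf_prop_iff, Finset.mem_univ, true_imp_iff,
      Function.comp_apply]
  refine ⟨fun j => Finset.univ.inf fun l => z l j, fun i j => (hinf i j).trans ⟨?_, ?_⟩⟩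
  · exact fun h => hz' i j (h i)
  · rintro rfl l
    exact hz l i

end PrimeFilters

section WithTopSet

variable {α : Type u} [PAlgebra α] {X : Type v}

theorem withTop_compl_coe {s : Set X} (hs : s.Nonempty) :
    (s : WithTop (Set X))ᶜ = ((sᶜ : Set X) : WithTop (Set X)) :=
  if_neg hs.ne_empty

theorem withTop_coe_eq_bot {s : Set X} : (s : WithTop (Set X)) = ⊥ ↔ s = ∅ :=
  WithTop.coe_eq_coe

open Classical in
theorem PrimeFilter.isHom_withTop (P : PrimeFilter α) {M : X → α → Prop}
    (hM : ∀ i, IsHom (M i)) (hPM : ∀ i, ⇑P ≤ M i)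
    (hcover : ∀ x, ¬ P x → ¬ P xᶜ → ∃ i, M i x) :
    IsHom fun x => if P x then (⊤ : WithTop (Set X)) else (({i | M i x} : Set X)) where
  map_bot := by
    rw [if_neg P.not_bot, withTop_coe_eq_bot]
    exact Set.eq_empty_of_forall_notMem fun i => of_eq_false (hM i).map_bot
  map_top := if_pos P.top
  map_inf x y := by
    have hinf : {i | M i (x ⊓ y)} = {i | M i x} ∩ {i | M i y} :=
      Set.ext fun i => iff_of_eq ((hM i).map_inf x y)
    have huniv {z : α} (hz : P z) : {i | M i z} = Set.univ := Set.eq_univ_of_forall (hPM · z hz)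
    by_cases hx : P x <;> by_cases hy : P y
    · simp [P.inf_iff, hx, hy]
    · simp [P.inf_iff, hx, hy, hinf, huniv hx]
    · simp [P.inf_iff, hx, hy, hinf, huniv hy]
    · rw [if_neg hx, if_neg hy, if_neg fun h => hx (P.inf_iff.1 h).1, hinf]
      exact WithTop.coe_inf _ _
  map_sup x y := by
    have hsup : {i | M i (x ⊔ y)} = {i | M i x} ∪ {i | M i y} :=
      Set.ext fun i => iff_of_eq ((hM i).map_sup x y)
    by_cases hx : P x
    · simp [P.sup_iff, hx]
    by_cases hy : P y
    · simp [P.sup_iff, hy]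
    rw [if_neg hx, if_neg hy, if_neg fun h => (P.sup_iff.1 h).elim hx hy, hsup]
    exact WithTop.coe_sup _ _
  map_compl x := by
    have hcompl : {i | M i xᶜ} = {i | M i x}ᶜ := Set.ext fun i => (hM i).compl_iff
    by_cases hx : P x
    · have hempty : {i | M i x}ᶜ = ∅ := by
        rw [Set.compl_empty_iff]
        exact Set.eq_univ_of_forall (hPM · x hx)
      rw [if_pos hx, if_neg fun h => P.not_of_compl h hx, hcompl, top_compl,
        withTop_coe_eq_bot, hempty]
    by_cases hxc : P xᶜ
    · have hempty : {i | M i x} = ∅ := Set.eq_empty_of_forall_notMem fun i hi =>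
        (hM i).compl_iff.1 (hPM i xᶜ hxc) hi
      rw [if_pos hxc, if_neg hx, eq_comm, compl_eq_top, withTop_coe_eq_bot, hempty]
    · rw [if_neg hx, if_neg hxc, withTop_compl_coe (s := {i | M i x}) (hcover x hx hxc), hcompl]

theorem PrimeFilter.exists_isHom_withTop (P : PrimeFilter α)
    (h : Nonempty ({M : α → Prop // IsHom M ∧ ⇑P < M} ↪ X)) :
    ∃ f : α → WithTop (Set X), IsHom f ∧ ∀ x, f x = ⊤ ↔ P x := by
  obtain ⟨e⟩ := h
  obtain ⟨M₀, hM₀, hPM₀, -⟩ := P.exists_isHom_le (x := ⊤) fun h => P.not_of_compl h P.top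
  let M : X → α → Prop := Function.extend e Subtype.val fun _ => M₀
  have hM (i : X) : IsHom (M i) ∧ ⇑P ≤ M i := by
    by_cases hi : ∃ N, e N = i
    · obtain ⟨N, rfl⟩ := hi
      rw [show M (e N) = N from e.injective.extend_apply _ _ N]
      exact ⟨N.2.1, N.2.2.le⟩
    · rw [show M i = M₀ from Function.extend_apply' _ _ i hi]
      exact ⟨hM₀, hPM₀⟩
  have hcover (x : α) (hx : ¬ P x) (hxc : ¬ P xᶜ) : ∃ i, M i x := by
    obtain ⟨N, hN, hPN, hNx⟩ := P.exists_isHom_le hxc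
    have hlt : ⇑P < N := lt_of_le_not_ge hPN fun hle => hx (hle x hNx)
    refine ⟨e ⟨N, hN, hlt⟩, ?_⟩
    rwa [show M (e ⟨N, hN, hlt⟩) = N from e.injective.extend_apply _ _ _]
  refine ⟨_, P.isHom_withTop (fun i => (hM i).1) (fun i => (hM i).2) hcover, fun x => ?_⟩
  simp only [ite_eq_left_iff, WithTop.coe_ne_top, imp_false, not_not]

theorem exists_isHom_withTop_ne
    (h : ∀ P : PrimeFilter α, Nonempty ({M : α → Prop // IsHom M ∧ ⇑P < M} ↪ X)) {a b : α}
    (hab : a ≠ b) : ∃ f : α → WithTop (Set X), IsHom f ∧ f a ≠ f b := by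
  obtain ⟨P, hP⟩ := exists_primeFilter_of_ne hab
  obtain ⟨f, hf, hfP⟩ := P.exists_isHom_withTop (h P)
  exact ⟨f, hf, fun heq => hP (by rw [← hfP, ← hfP, heq])⟩

theorem exists_eq_bot_of_pairwise_disjoint [Fintype X] {ι : Type*} [Fintype ι]
    (hcard : Fintype.card X < Fintype.card ι) {w : ι → WithTop (Set X)} (hw : ∀ i, w i ≠ ⊤)
    (hdisj : Pairwise (Function.onFun Disjoint w)) : ∃ i, w i = ⊥ := by
  by_contra! hbot
  choose s hs using fun i => WithTop.ne_top_iff_exists.1 (hw i)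
  have hne (i : ι) : (s i).Nonempty :=
    Set.nonempty_iff_ne_empty.2 fun h => hbot i (by rw [← hs, h]; rfl)
  choose p hp using hne
  obtain ⟨i, j, hij, hpij⟩ := Fintype.exists_ne_map_eq_of_card_lt p hcard
  have hempty : s i ∩ s j = ∅ := by
    rw [← withTop_coe_eq_bot, ← disjoint_iff.1 (hdisj hij), ← hs, ← hs]
    rfl
  exact hempty.le ⟨hp i, hpij ▸ hp j⟩

end WithTopSet

section LeeIdentities

/-- The term `τ 0 ⊔ ⋯ ⊔ τ (n - 1)`. -/
def Term.join (τ : ℕ → Term) : ℕ → Term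
  | 0 => .bot
  | n + 1 => .sup (join τ n) (τ n)

theorem Term.eval_join {α : Type*} [PAlgebra α] (τ : ℕ → Term) (v : ℕ → α) (n : ℕ) :
    (join τ n).eval v = (Finset.range n).sup fun i => (τ i).eval v := by
  induction n with
  | zero => rfl
  | succ n ih => rw [Finset.range_add_one, Finset.sup_insert, sup_comm, ← ih]; rfl

/-- The identity `x₀ ⊔ ⋁_{i ≤ k} (xᵢ ⊓ (⋁_{j < i} xⱼ)ᶜ)ᶜ = ⊤`, which axiomatises `Paₖ`. It is a form
of Lee's identity in which the join with `x₀` is added to include the case `k = 0`. -/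
def leeIdentity (k : ℕ) : QuasiIdentity where
  premises := []
  conclusion := (.sup (.var 0)
    (.join (fun i => .compl (.inf (.var i) (.compl (.join .var i)))) (k + 1)), .top)

theorem satisfies_leeIdentity_iff {A : PAlg.{u}} {k : ℕ} :
    Satisfies A (leeIdentity k) ↔
      ∀ v : ℕ → A, v 0 ⊔ (Finset.range (k + 1)).sup (fun i => (disjointPart v i)ᶜ) = ⊤ := by
  simp only [Satisfies, leeIdentity, List.not_mem_nil, false_imp_iff, implies_true, true_imp_iff,
    Term.eval, Term.eval_join, disjointPart]

theorem satisfies_leeIdentity_withTop {X : Type u} [Fintype X] {k : ℕ} (hX : Fintype.card X ≤ k) :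
    Satisfies ⟨WithTop (Set X)⟩ (leeIdentity k) := by
  refine satisfies_leeIdentity_iff.2 fun (v : ℕ → WithTop (Set X)) => by_contra fun hne => ?_
  have hv : v 0 ≠ ⊤ := fun h => hne (top_le_iff.1 (h.ge.trans le_sup_left))
  have hbot (i : Fin (k + 1)) : disjointPart v i ≠ ⊥ := fun h =>
    hne (top_le_iff.1 ((compl_eq_top.2 h).ge.trans
      ((Finset.le_sup (f := fun i => (disjointPart v i)ᶜ) (Finset.mem_range.2 i.2)).trans
        le_sup_right)))
  have htop (i : Fin (k + 1)) : disjointPart v i ≠ ⊤ := by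
    intro h
    rcases eq_or_ne i 0 with rfl | hi
    · exact hv ((disjointPart_zero v).symm.trans h)
    · have hdisj := pairwise_disjoint_disjointPart v (Fin.val_injective.ne hi)
      exact hbot 0 (top_disjoint.1 (h ▸ hdisj))
  obtain ⟨i, hi⟩ := exists_eq_bot_of_pairwise_disjoint (by simpa using Nat.lt_succ_of_le hX) htop
    ((pairwise_disjoint_disjointPart v).comp_of_injective Fin.val_injective)
  exact hbot i hi

theorem IsHom.disjointPart_iff {α : Type*} [PAlgebra α] {M : α → Prop} (hM : IsHom M) {v : ℕ → α}
    {i : ℕ} : M (disjointPart v i) ↔ M (v i) ∧ ∀ j < i, ¬ M (v j) := by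
  rw [disjointPart, iff_of_eq (hM.map_inf _ _)]
  refine and_congr_right fun _ => ?_
  rw [hM.compl_iff, hM.map_finset_sup, finset_sup_prop_iff]
  simp only [Finset.mem_range, Function.comp_apply, not_exists, not_and]

theorem nonempty_embedding_fin_of_isEmpty {α : Type*} {k : ℕ} (h : IsEmpty (Fin (k + 1) ↪ α)) :
    Nonempty (α ↪ Fin k) := by
  have : Finite α := by
    by_contra hinf
    have := not_finite_iff_infinite.1 hinf
    exact h.false (Fin.valEmbedding.trans (Infinite.natEmbedding α))
  have := Fintype.ofFinite α
  refine Function.Embedding.nonempty_of_card_le ?_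
  rw [Fintype.card_fin, ← Nat.lt_succ_iff, ← not_le]
  intro hle
  have : Nonempty (Fin (k + 1) ↪ α) := Function.Embedding.nonempty_of_card_le (by simpa using hle)
  exact not_isEmpty_of_nonempty _ h

theorem PrimeFilter.isEmpty_embedding_of_satisfies_leeIdentity {A : PAlg.{u}} {k : ℕ}
    (P : PrimeFilter A) (hA : Satisfies A (leeIdentity k)) :
    IsEmpty (Fin (k + 1) ↪ {M : A → Prop // IsHom M ∧ ⇑P < M}) := by
  refine ⟨fun e => ?_⟩
  let M (i : Fin (k + 1)) : A → Prop := e i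
  have hM (i) : IsHom (M i) := (e i).2.1
  have hPM (i) : ⇑P ≤ M i := (e i).2.2.le
  obtain ⟨y, hy⟩ := exists_apply_iff_eq hM (Subtype.val_injective.comp e.injective)
  have hd (i) : ∃ d, M i d ∧ ¬ P d := by
    simpa only [Pi.le_def, not_forall, le_Prop_eq, exists_prop] using (e i).2.2.not_ge
  choose d hMd hPd using hd
  let v : ℕ → A := Function.extend Fin.val (fun i : Fin (k + 1) => y i ⊓ d i) ⊥
  have hv (i : Fin (k + 1)) : v i = y i ⊓ d i := Fin.val_injective.extend_apply _ _ i
  have hMv (i j : Fin (k + 1)) : M i (v j) ↔ i = j := by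
    rw [hv, iff_of_eq ((hM i).map_inf _ _)]
    exact ⟨fun h => (hy i j).1 h.1, fun h => ⟨(hy i j).2 h, h ▸ hMd i⟩⟩
  have hMpart (i : Fin (k + 1)) : M i (disjointPart v i) :=
    (hM i).disjointPart_iff.2 ⟨(hMv i i).2 rfl, fun j hj h =>
      hj.ne' (congrArg Fin.val ((hMv i ⟨j, hj.trans i.2⟩).1 h))⟩
  rcases P.sup_iff.1 (satisfies_leeIdentity_iff.1 hA v ▸ P.top) with h0 | hsup
  · exact hPd 0 (P.mono inf_le_right (hv 0 ▸ h0))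
  · rw [map_finset_sup, finset_sup_prop_iff] at hsup
    obtain ⟨i, hi, hPi⟩ := hsup
    exact (hM ⟨i, Finset.mem_range.1 hi⟩).compl_iff.1 (hPM _ _ hPi) (hMpart _)

end LeeIdentities

section Quasivarieties

/-- `C` separates the points of `A`: homomorphisms from `A` to members of `C` distinguish any two
points. Equivalently, `A` is a subdirect product of subalgebras of members of `C`. -/
def SeparatedBy (C : Set PAlg.{u}) (A : PAlg.{u}) : Prop :=
  ∀ a b : A, a ≠ b → ∃ B ∈ C, ∃ f : A → B, IsHom f ∧ f a ≠ f b

variable {A B : PAlg.{u}} {C K : Set PAlg.{u}} {q : QuasiIdentity}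

theorem mem_S_P_iff : A ∈ S (P C) ↔ SeparatedBy C A := by
  constructor
  · rintro ⟨B, ⟨ι, F, hF, g, hg, hginj, -⟩, f, hf, hfinj⟩ a b hab
    obtain ⟨i, hi⟩ := Function.ne_iff.1 (hginj.ne (hfinj.ne hab))
    exact ⟨F i, hF i, _, (isHom_eval (fun i => F i) i).comp (hg.comp hf), hi⟩
  · intro h
    choose F hF f hf hne using fun p : {p : A × A // p.1 ≠ p.2} => h p.1.1 p.1.2 p.2
    refine ⟨⟨∀ p, F p⟩, ⟨_, F, hF, id, isHom_id, Function.bijective_id⟩, _, isHom_pi hf, ?_⟩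
    exact fun a b hab => by_contra fun hne' => hne ⟨(a, b), hne'⟩ (congrFun hab ⟨(a, b), hne'⟩)

theorem SeparatedBy.satisfies (hA : SeparatedBy C A) (hC : ∀ B ∈ C, Satisfies B q) :
    Satisfies A q := by
  intro v hv
  by_contra hne
  obtain ⟨B, hB, f, hf, hfne⟩ := hA _ _ hne
  refine hfne ?_
  rw [hf.map_eval, hf.map_eval]
  exact hC B hB _ fun e he => by rw [← hf.map_eval, ← hf.map_eval, hv e he]

theorem Satisfies.of_surjective (hA : Satisfies A q) (hq : q.premises = []) {f : A → B}
    (hf : IsHom f) (hsurj : Function.Surjective f) : Satisfies B q := by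
  intro v _
  obtain ⟨w, rfl⟩ := hsurj.comp_left v
  rw [← hf.map_eval, ← hf.map_eval, hA w (by simp [hq])]

theorem IsQuasivariety.mem_of_separatedBy (hK : IsQuasivariety K) (hC : C ⊆ K)
    (hA : SeparatedBy C A) : A ∈ K := by
  obtain ⟨Γ, rfl⟩ := hK
  exact fun q hq => hA.satisfies fun B hB => hC hB q hq

theorem IsQuasivariety.mem_of_injective (hK : IsQuasivariety K) (hB : B ∈ K) {f : A → B}
    (hf : IsHom f) (hinj : Function.Injective f) : A ∈ K :=
  hK.mem_of_separatedBy (Set.singleton_subset_iff.2 hB) fun _ _ hab =>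
    ⟨B, rfl, f, hf, hinj.ne hab⟩

theorem IsQuasivariety.mem_of_subsingleton (hK : IsQuasivariety K) [Subsingleton A] : A ∈ K :=
  hK.mem_of_separatedBy (Set.empty_subset K) fun a b hab => absurd (Subsingleton.elim a b) hab

theorem IsQuasivariety.prod_mem (hK : IsQuasivariety K) (hA : A ∈ K) (hB : B ∈ K) :
    (⟨A × B⟩ : PAlg.{u}) ∈ K := by
  refine hK.mem_of_separatedBy Set.Subset.rfl fun (x y : A × B) hxy => ?_
  rcases not_and_or.1 (mt Prod.ext_iff.2 hxy) with h | h
  · exact ⟨A, hA, Prod.fst, isHom_fst, h⟩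
  · exact ⟨B, hB, Prod.snd, isHom_snd, h⟩

/-- If `A` is nontrivial then it has a homomorphism `f` to `B`, and `x ↦ (x, f x)` embeds it in the
product. -/
theorem IsQuasivariety.left_mem_of_prod_mem (hK : IsQuasivariety K)
    (h : (⟨A × B⟩ : PAlg.{u}) ∈ K) : A ∈ K := by
  rcases subsingleton_or_nontrivial A with _ | _
  · exact hK.mem_of_subsingleton
  · obtain ⟨f, hf⟩ := exists_isHom_of_nontrivial (α := A) B
    exact hK.mem_of_injective h (isHom_id.prodMk hf) fun x y hxy => congrArg Prod.fst hxy

theorem IsQuasivariety.right_mem_of_prod_mem (hK : IsQuasivariety K)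
    (h : (⟨A × B⟩ : PAlg.{u}) ∈ K) : B ∈ K :=
  hK.left_mem_of_prod_mem (B := A)
    (hK.mem_of_injective h (isHom_snd.prodMk isHom_fst) Prod.swap_injective)

theorem mem_Q_self (A : PAlg.{u}) : A ∈ Q {A} := fun _ hL => hL.2 rfl

theorem Q_subset (hK : IsQuasivariety K) (h : C ⊆ K) : Q C ⊆ K :=
  Set.sInter_subset_of_mem ⟨hK, h⟩

theorem mem_Q_iff : A ∈ Q C ↔ ∀ q, (∀ B ∈ C, Satisfies B q) → Satisfies A q := by
  constructor
  · exact fun hA q hq => hA {B | Satisfies B q} ⟨⟨{q}, by simp⟩, hq⟩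
  · rintro hA L ⟨⟨Γ, rfl⟩, hCL⟩ q hq
    exact hA q fun B hB => hCL hB q hq

theorem isQuasivariety_Q (C : Set PAlg.{u}) : IsQuasivariety (Q C) :=
  ⟨{q | ∀ A ∈ C, Satisfies A q}, Set.ext fun _ => mem_Q_iff⟩

theorem IsCover.eq_Q {V : Set PAlg.{u}} (hVK : IsCover V K) (hA : A ∈ K) (hAV : A ∉ V)
    (hV : V ⊆ Q {A}) : K = Q {A} := by
  obtain ⟨hK, -, hmin⟩ := hVK
  have hsub : Q {A} ⊆ K := Q_subset hK (Set.singleton_subset_iff.2 hA)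
  have hlt : V ⊂ Q {A} := hV.ssubset_of_mem_notMem (mem_Q_self A) hAV
  exact (hsub.eq_of_not_ssubset (hmin _ (isQuasivariety_Q {A}) hlt)).symm

end Quasivarieties

section Varieties

theorem satisfies_leeIdentity_Bbar (k : ℕ) : Satisfies (Bbar.{u} k) (leeIdentity k) :=
  satisfies_leeIdentity_withTop (X := ULift.{u} (Fin k))
    (by rw [Fintype.card_ulift, Fintype.card_fin])

theorem SeparatedBy.satisfies_leeIdentity {A : PAlg.{u}} {k : ℕ}
    (hA : SeparatedBy {Bbar k} A) : Satisfies A (leeIdentity k) :=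
  hA.satisfies (forall_eq.2 (satisfies_leeIdentity_Bbar k))

theorem SeparatedBy.of_satisfies_leeIdentity {A : PAlg.{u}} {k : ℕ}
    (hA : Satisfies A (leeIdentity k)) : SeparatedBy {Bbar k} A := by
  intro a b hab
  have hemb (P : PrimeFilter A) :
      Nonempty ({M : A → Prop // IsHom M ∧ ⇑P < M} ↪ ULift.{u} (Fin k)) :=
    (nonempty_embedding_fin_of_isEmpty (P.isEmpty_embedding_of_satisfies_leeIdentity hA)).map
      fun e => e.trans Equiv.ulift.symm.toEmbedding
  exact ⟨Bbar k, rfl, exists_isHom_withTop_ne hemb hab⟩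

theorem Pa_coe_eq_Q (k : ℕ) : Pa.{u} k = Q {Bbar k} := by
  refine Set.Subset.antisymm ?_ fun A hA => ?_
  · rintro A ⟨B, hB, f, hf, hsurj⟩
    have hA : Satisfies A (leeIdentity k) :=
      (mem_S_P_iff.1 hB).satisfies_leeIdentity.of_surjective rfl hf hsurj
    exact (isQuasivariety_Q _).mem_of_separatedBy (Set.singleton_subset_iff.2 (mem_Q_self _))
      (.of_satisfies_leeIdentity hA)
  · have hA : Satisfies A (leeIdentity k) :=
      mem_Q_iff.1 hA _ (forall_eq.2 (satisfies_leeIdentity_Bbar k))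
    exact ⟨A, mem_S_P_iff.2 (.of_satisfies_leeIdentity hA), id, isHom_id, Function.surjective_id⟩

theorem Pa_bot_eq_Q : Pa.{u} ⊥ = Q {⟨PUnit⟩} := by
  refine Set.Subset.antisymm ?_ fun A hA => ?_
  · intro A (_ : Subsingleton A)
    exact (isQuasivariety_Q _).mem_of_subsingleton
  · have hA : Satisfies A ⟨[], (.bot, .top)⟩ :=
      mem_Q_iff.1 hA _ (forall_eq.2 fun _ _ => rfl)
    exact subsingleton_of_bot_eq_top (hA (fun _ => ⊥) (by simp))

theorem exists_finite_Pa_eq_Q (m : WithBot ℕ) : ∃ D : PAlg.{u}, Finite D ∧ Pa m = Q {D} := by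
  cases m with
  | bot => exact ⟨⟨PUnit⟩, inferInstanceAs (Finite PUnit), Pa_bot_eq_Q⟩
  | coe k =>
    exact ⟨Bbar k, inferInstanceAs (Finite (Option (Set (ULift (Fin k))))), Pa_coe_eq_Q k⟩

end Varieties

section LocalFiniteness

variable {α : Type u} [PAlgebra α]

/-- The subalgebra generated by the entries of `v`. -/
def generated (v : ℕ → α) : Set α :=
  Set.range fun t : Term => t.eval v

instance instPAlgebraGenerated (v : ℕ → α) : PAlgebra (generated v) where
  __ := Subtype.lattice (P := (· ∈ generated v))
    (by rintro _ _ ⟨s, rfl⟩ ⟨t, rfl⟩; exact ⟨.sup s t, rfl⟩)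
    (by rintro _ _ ⟨s, rfl⟩ ⟨t, rfl⟩; exact ⟨.inf s t, rfl⟩)
  __ := Subtype.boundedOrder (p := (· ∈ generated v)) ⟨.bot, rfl⟩ ⟨.top, rfl⟩
  le_sup_inf x y z := le_sup_inf (x := x.1) (y := y.1) (z := z.1)
  compl x := ⟨x.1ᶜ, by obtain ⟨_, t, rfl⟩ := x; exact ⟨.compl t, rfl⟩⟩
  inf_eq_bot_iff_le_compl x y :=
    Subtype.ext_iff.trans (PAlgebra.inf_eq_bot_iff_le_compl x.1 y.1)

theorem isHom_generated_val (v : ℕ → α) : IsHom (Subtype.val : generated v → α) :=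
  ⟨rfl, rfl, fun _ _ => rfl, fun _ _ => rfl, fun _ => rfl⟩

/-- The entries of `v`, as elements of the subalgebra they generate. -/
def generator (v : ℕ → α) (i : ℕ) : generated v :=
  ⟨v i, .var i, rfl⟩

theorem coe_eval_generator (v : ℕ → α) (t : Term) :
    (t.eval (generator v) : generated v).1 = t.eval v :=
  (isHom_generated_val v).map_eval (generator v) t

theorem surjective_eval_generator (v : ℕ → α) :
    Function.Surjective fun t : Term => t.eval (generator v) := by
  rintro ⟨_, t, rfl⟩
  exact ⟨t, Subtype.ext (coe_eval_generator v t)⟩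

theorem finite_isHom {v : ℕ → α} (hv : (Set.range v).Finite)
    (hgen : Function.Surjective fun t : Term => t.eval v) (β : Type*) [PAlgebra β] [Finite β] :
    Finite {f : α → β // IsHom f} := by
  have := hv.to_subtype
  refine Finite.of_injective
    (fun (f : {f : α → β // IsHom f}) (x : Set.range v) => f.1 x) fun f g hfg => ?_
  have hvar : f.1 ∘ v = g.1 ∘ v := funext fun i => congrFun hfg ⟨v i, i, rfl⟩
  refine Subtype.ext (funext fun x => ?_)
  obtain ⟨t, rfl⟩ := hgen x
  rw [f.2.map_eval, g.2.map_eval, hvar]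

/-- By `exists_isHom_withTop_ne`, homomorphisms to the finite algebra `WithTop (Set X)` separate
points, where `X` is the set of homomorphisms to `Prop`. -/
theorem finite_of_surjective_eval {v : ℕ → α} (hv : (Set.range v).Finite)
    (hgen : Function.Surjective fun t : Term => t.eval v) : Finite α := by
  let X := {M : α → Prop // IsHom M}
  have : Finite X := finite_isHom hv hgen Prop
  have : Finite (WithTop (Set X)) := inferInstanceAs (Finite (Option (Set X)))
  have := finite_isHom hv hgen (WithTop (Set X))
  refine Finite.of_injective (fun a (f : {f : α → WithTop (Set X) // IsHom f}) => f.1 a)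
    fun a b hab => by_contra fun hne => ?_
  obtain ⟨f, hf, hfne⟩ := exists_isHom_withTop_ne (X := X)
    (fun P => ⟨Subtype.impEmbedding _ _ fun _ h => h.1⟩) hne
  exact hfne (congrFun hab ⟨f, hf⟩)

theorem finite_generated {v : ℕ → α} (hv : (Set.range v).Finite) : Finite (generated v) := by
  refine finite_of_surjective_eval (v := generator v) ?_ (surjective_eval_generator v)
  refine Set.Finite.of_finite_image (f := Subtype.val) ?_ Subtype.val_injective.injOn
  rwa [← Set.range_comp]

theorem Term.eventually_eval_eq (v : ℕ → α) (t : Term) :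
    ∀ᶠ N in Filter.atTop, t.eval (fun n => if n < N then v n else ⊥) = t.eval v := by
  induction t with
  | var n => exact (Filter.eventually_gt_atTop n).mono fun N hN => if_pos hN
  | bot | top => exact .of_forall fun _ => rfl
  | inf s t hs ht | sup s t hs ht =>
    filter_upwards [hs, ht] with N hs ht
    rw [Term.eval, hs, ht, Term.eval]
  | compl t ht =>
    filter_upwards [ht] with N ht
    rw [Term.eval, ht, Term.eval]

theorem exists_range_finite_of_not_satisfies {A : PAlg.{u}} {q : QuasiIdentity}
    (hq : ¬ Satisfies A q) : ∃ v : ℕ → A, (Set.range v).Finite ∧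
      (∀ e ∈ q.premises, e.1.eval v = e.2.eval v) ∧
        q.conclusion.1.eval v ≠ q.conclusion.2.eval v := by
  obtain ⟨v, hprem, hconcl⟩ : ∃ v : ℕ → A, (∀ e ∈ q.premises, e.1.eval v = e.2.eval v) ∧
      q.conclusion.1.eval v ≠ q.conclusion.2.eval v := by
    simpa only [Satisfies, not_forall, exists_prop] using hq
  have htrunc := (Filter.eventually_all_finite (List.finite_toSet q.premises)).2 fun e _ =>
    (e.1.eventually_eval_eq v).and (e.2.eventually_eval_eq v)
  obtain ⟨N, hN, hN₁, hN₂⟩ := (htrunc.and ((q.conclusion.1.eventually_eval_eq v).and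
    (q.conclusion.2.eventually_eval_eq v))).exists
  refine ⟨fun n => if n < N then v n else ⊥, ?_, fun e he => ?_, ?_⟩
  · refine (((Set.finite_Iio N).image v).insert ⊥).subset ?_
    rintro _ ⟨n, rfl⟩
    by_cases hn : n < N
    · exact .inr ⟨n, hn, (if_pos hn).symm⟩
    · exact .inl (if_neg hn)
  · rw [(hN e he).1, (hN e he).2, hprem e he]
  · rwa [hN₁, hN₂]

theorem exists_finite_mem_notMem {V K : Set PAlg.{u}} (hV : IsQuasivariety V)
    (hK : IsQuasivariety K) (hVK : ¬ K ⊆ V) : ∃ C ∈ K, Finite C ∧ C ∉ V := by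
  obtain ⟨A, hAK, hAV⟩ := Set.not_subset.1 hVK
  obtain ⟨Γ, rfl⟩ := hV
  obtain ⟨q, hq, hAq⟩ : ∃ q ∈ Γ, ¬ Satisfies A q := by
    simpa only [Set.mem_ofPred_eq, not_forall, exists_prop] using hAV
  obtain ⟨v, hv, hprem, hconcl⟩ := exists_range_finite_of_not_satisfies hAq
  refine ⟨⟨generated v⟩, hK.mem_of_injective hAK (isHom_generated_val v) Subtype.val_injective,
    finite_generated hv, fun hgen => hconcl ?_⟩
  have heq := hgen q hq (generator v) fun e he => Subtype.ext <| by
    rw [coe_eval_generator, coe_eval_generator, hprem e he]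
  simpa only [coe_eval_generator] using congrArg Subtype.val heq

end LocalFiniteness

end PAlg

open PAlg in
theorem lemma2p1_general {D : PAlg.{u}} [Finite D] {K : Set PAlg.{u}} (hK : IsCover (Q {D}) K) :
    ∃ A : PAlg.{u}, Finite A ∧ K = Q {A} := by
  have hV := isQuasivariety_Q {D}
  obtain ⟨C, hCK, _, hCV⟩ := exists_finite_mem_notMem hV hK.1 hK.2.1.not_subset
  have hDK : D ∈ K := hK.2.1.subset (mem_Q_self D)
  have hDA : D ∈ Q {⟨C × D⟩} := (isQuasivariety_Q _).right_mem_of_prod_mem (mem_Q_self _)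
  exact ⟨⟨C × D⟩, inferInstanceAs (Finite (C × D)),
    hK.eq_Q (hK.1.prod_mem hCK hDK) (fun h => hCV (hV.left_mem_of_prod_mem h))
      (Q_subset (isQuasivariety_Q _) (Set.singleton_subset_iff.2 hDA))⟩

theorem lemma2p1 (m : WithBot ℕ) (K : Set PAlg.{u}) (hK : PAlg.IsCover (PAlg.Pa m) K) :
    ∃ A : PAlg.{u}, Finite A ∧ K = PAlg.Q {A} := by
  obtain ⟨D, _, hD⟩ := PAlg.exists_finite_Pa_eq_Q m
  exact lemma2p1_general (hD ▸ hK)
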